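/- Let $T:\mathsf{Pos}\to\mathsf{Pos}$ be an endofunctor of the category of posets and monotone maps which is finitary (preserves filtered colimits), locally monotone ($f\le g$ implies $Tf\le Tg$), preserves exact squares (a square of monotone maps with $fp_0\le gp_1$ is exact if $fa\le gb$ implies that some $w$ satisfies $a\le p_0w$ and $p_1w\le b$) and preserves finite intersections of order-embeddings. Let $T^\partial X=(TX^{op})^{op}$. Let $\mathbb L_\omega X$ be the poset of finitely generated lowersets of $X$, ordered by inclusion, and $\mathbb U_\omega X=(\mathbb L_\omega X^{op})^{op}$ the poset of finitely generated uppersets, ordered by reversed inclusion. A monotone relation $R$ from $X$ to $Y$ is a monotone map $Y^{op}\times X\to\{0<1\}$. View $R$ as the set of related pairs $(y,x)$, ordered componentwise, with projections $p_0,p_1$ to $Y$ and $X$. Its lifting $\overline TR$ from $TX$ to $TY$ is given by: $\overline TR(\beta,\alpha)$ iff there is $w\in T(R)$ with $\beta\le Tp_0(w)$ and $Tp_1(w)\le\alpha$. Fix a poset $\mathsf{At}$ of atoms. The language $\mathcal L$ is the free algebra on $\mathsf{At}$, in $\mathsf{Pos}$, for the functor $\mathbb U_\omega+\mathbb L_\omega+T^\partial+T^\partial$;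 the components of its structure are $\bigwedge:\mathbb U_\omega\mathcal L\to\mathcal L$, $\bigvee:\mathbb L_\omega\mathcal L\to\mathcal L$ and $\nabla,\Delta:T^\partial\mathcal L\to\mathcal L$. For a coalgebra $c:X\to TX$ and a monotone valuation of the atoms, that is, a monotone relation from $\mathsf{At}$ to $X^{op}$, the semantics relation $\Vdash$, a monotone relation from $\mathcal L$ to $X^{op}$, extends the valuation and satisfies: $x\Vdash\bigwedge\varphi$ iff $x\Vdash a$ for all $a\in\varphi$; $x\Vdash\bigvee\psi$ iff $x\Vdash a$ for some $a\in\psi$; $x\Vdash\nabla\alpha$ iff $c(x)\mathrel{\overline{T^\partial}{\Vdash}}\alpha$; $x\nVdash\Delta\alpha$ iff $c(x)\mathrel{\overline T{\nVdash}}\alpha$. Two formulas are semantically equivalent, $a\equiv b$, if they hold at the same states of all coalgebras under all valuations. Let $\alpha\in T^\partial\mathcal L$. Let $\notin$ be the negated membership relation, a monotone relation from $(\mathbb L_\omega\mathcal L)^{op}$ to $\mathcal L^{op}$, and for $\Psi\in T^\partial\mathbb L_\omega\mathcal L$ write $\alpha\mathrel{\neg\overline T{\notin}}\Psi$ if $\alpha$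 and $\Psi$ are not related by the lifting $\overline T{\notin}$. Let $\mathrm{base}(\alpha)\subseteq\mathcal L$ be the least subposet $S$ of $\mathcal L$ such that $\alpha$ lies in the subobject $T^\partial S$ of $T^\partial\mathcal L$ (it exists and is finite), and let $R_\alpha$ be the set of all $\Psi\in T^\partial\mathbb L_\omega\mathrm{base}(\alpha)$ with $\alpha\mathrel{\neg\overline T{\notin}}\Psi$, where $\Psi$ is regarded as an element of $T^\partial\mathbb L_\omega\mathcal L$ along the inclusion. **Proposition.** (1) For every coalgebra $c:X\to TX$, every monotone valuation of the atoms and every $x\in X$, $$x\Vdash\nabla\alpha\iff \text{for every }\Psi\in T^\partial\mathbb L_\omega\mathcal L:\ \ \alpha\mathrel{\neg\overline T{\notin}}\Psi\ \text{ implies }\ x\Vdash\Delta\bigl(T^\partial\textstyle\bigvee\bigr)\Psi .$$ (2) Whenever $R_\alpha$ is finite, $$\nabla\alpha\ \equiv\bigwedge_{\Psi\in R_\alpha}\Delta\bigl(T^\partial\textstyle\bigvee\bigr)\Psi .$$ -/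

import Mathlib

open CategoryTheory CategoryTheory.Limits

universe u

namespace MossLogic

/-! ### Monotone relations and relation lifting -/

/-- A monotone relation `X ⇸ Y`, that is, a monotone map `Yᵒᵖ × X → 𝟚`;
`rel y x` says that `x` is related to `y`. -/
structure MRel (X Y : PartOrd.{u}) where
  rel : Y → X → Prop
  mono : ∀ {y y' : Y} {x x' : X}, rel y x → y' ≤ y → x ≤ x' → rel y' x'

/-- The tabulation of a relation: the related pairs, ordered componentwise. -/
def MRel.graph {X Y : PartOrd.{u}} (R : MRel X Y) : PartOrd.{u} :=
  PartOrd.of {p : Y × X // R.rel p.1 p.2}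

/-- The projection from the tabulation to the codomain. -/
def MRel.p₀ {X Y : PartOrd.{u}} (R : MRel X Y) : R.graph ⟶ Y :=
  PartOrd.ofHom ⟨fun p => p.1.1, fun _ _ h => h.1⟩

/-- The projection from the tabulation to the domain. -/
def MRel.p₁ {X Y : PartOrd.{u}} (R : MRel X Y) : R.graph ⟶ X :=
  PartOrd.ofHom ⟨fun p => p.1.2, fun _ _ h => h.2⟩

/-- The relation lifting `T̄R : TX ⇸ TY` of `R : X ⇸ Y`. -/
def lift (T : PartOrd.{u} ⥤ PartOrd.{u}) {X Y : PartOrd.{u}} (R : MRel X Y) :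
    MRel (T.obj X) (T.obj Y) where
  rel b a := ∃ w : T.obj R.graph, b ≤ T.map R.p₀ w ∧ T.map R.p₁ w ≤ a
  mono := by
    rintro y y' x x' ⟨w, h₁, h₂⟩ hy hx
    exact ⟨w, hy.trans h₁, h₂.trans hx⟩

/-! ### Assumptions on the functor -/

/-- The dual functor `T^∂ X = (T Xᵒᵖ)ᵒᵖ`. -/
abbrev dualFunctor (T : PartOrd.{u} ⥤ PartOrd.{u}) : PartOrd.{u} ⥤ PartOrd.{u} :=
  PartOrd.dual ⋙ T ⋙ PartOrd.dual

/-- `T` is locally monotone: `f ≤ g` pointwise implies `T f ≤ T g` pointwise. -/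
def LocallyMonotone (T : PartOrd.{u} ⥤ PartOrd.{u}) : Prop :=
  ∀ ⦃X Y : PartOrd.{u}⦄ (f g : X ⟶ Y), (∀ x, f x ≤ g x) → ∀ t, T.map f t ≤ T.map g t

/-- The lax square `f p₀ ≤ g p₁` is exact. -/
def ExactSquare {P A B C : PartOrd.{u}} (p₀ : P ⟶ A) (p₁ : P ⟶ B) (f : A ⟶ C) (g : B ⟶ C) :
    Prop :=
  (∀ w, f (p₀ w) ≤ g (p₁ w)) ∧
    ∀ a b, f a ≤ g b → ∃ w, a ≤ p₀ w ∧ p₁ w ≤ b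

/-- `T` preserves exact squares (the Beck-Chevalley Condition). -/
def PreservesExactSquares (T : PartOrd.{u} ⥤ PartOrd.{u}) : Prop :=
  ∀ ⦃P A B C : PartOrd.{u}⦄ (p₀ : P ⟶ A) (p₁ : P ⟶ B) (f : A ⟶ C) (g : B ⟶ C),
    ExactSquare p₀ p₁ f g → ExactSquare (T.map p₀) (T.map p₁) (T.map f) (T.map g)

/-- A monotone map that reflects the order. -/
def IsOrderEmbedding {X Y : PartOrd.{u}} (f : X ⟶ Y) : Prop :=
  ∀ x y, f x ≤ f y → x ≤ y

/-- `T` preserves finite intersections of order-embeddings, i.e. their pullbacks (the empty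
intersection is an identity, and so is preserved by every functor). -/
def PreservesFiniteIntersections (T : PartOrd.{u} ⥤ PartOrd.{u}) : Prop :=
  ∀ ⦃P A B X : PartOrd.{u}⦄ (p : P ⟶ A) (q : P ⟶ B) (m : A ⟶ X) (n : B ⟶ X),
    IsOrderEmbedding m → IsOrderEmbedding n → IsPullback p q m n →
      IsPullback (T.map p) (T.map q) (T.map m) (T.map n)

/-! ### Finitely generated lowersets and uppersets -/

/-- The functor `𝕃_ω` of finitely generated lowersets, ordered by inclusion. -/
def Lω : PartOrd.{u} ⥤ PartOrd.{u} where
  obj X := PartOrd.of {l : LowerSet X // ∃ s : Set X, s.Finite ∧ l = lowerClosure s}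
  map {X Y} f := PartOrd.ofHom
    { toFun := fun l => ⟨lowerClosure (f '' (l.1 : Set X)), by
        obtain ⟨l, s, hs, rfl⟩ := l
        refine ⟨f '' s, hs.image _, le_antisymm ?_ (lowerClosure_mono
          (Set.image_mono subset_lowerClosure))⟩
        rw [lowerClosure_le]
        rintro _ ⟨x, ⟨y, hy, hxy⟩, rfl⟩
        exact ⟨f y, ⟨y, hy, rfl⟩, f.hom.monotone hxy⟩⟩
      monotone' := fun l l' h => lowerClosure_mono (Set.image_mono h) }
  map_id X := by
    refine PartOrd.ext fun l => Subtype.ext ?_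
    change lowerClosure ((fun x : X => x) '' (l.1 : Set X)) = l.1
    simp
  map_comp {X Y Z} f g := by
    refine PartOrd.ext fun l => Subtype.ext ?_
    change lowerClosure ((f ≫ g) '' (l.1 : Set X)) =
      lowerClosure (g '' (lowerClosure (f '' (l.1 : Set X)) : Set Y))
    apply le_antisymm
    · rw [lowerClosure_le]
      rintro _ ⟨x, hx, rfl⟩
      exact ⟨g (f x), ⟨f x, subset_lowerClosure ⟨x, hx, rfl⟩, rfl⟩, le_rfl⟩
    · rw [lowerClosure_le]
      rintro _ ⟨y, ⟨_, ⟨x, hx, rfl⟩, hy⟩, rfl⟩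
      exact ⟨g (f x), ⟨x, hx, rfl⟩, g.hom.monotone hy⟩

/-- The functor `𝕌_ω` of finitely generated uppersets, ordered by reversed inclusion: the dual
of `𝕃_ω`. (An upperset of `X` is a lowerset of `Xᵒᵖ`.) -/
abbrev Uω : PartOrd.{u} ⥤ PartOrd.{u} := dualFunctor Lω

/-- Membership in a finitely generated lowerset. -/
def memL {X : PartOrd.{u}} (x : X) (l : Lω.obj X) : Prop :=
  x ∈ (show {l : LowerSet X // ∃ s : Set X, s.Finite ∧ l = lowerClosure s} from l).1

/-- Membership in a finitely generated upperset. -/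
def memU {X : PartOrd.{u}} (x : X) (v : Uω.obj X) : Prop :=
  memL (X := PartOrd.dual.obj X) (OrderDual.toDual x) (OrderDual.ofDual v)

/-- The lowerset generated by a finite set. -/
def genL {X : PartOrd.{u}} (s : Set X) (hs : s.Finite) : Lω.obj X :=
  ⟨lowerClosure s, s, hs, rfl⟩

/-- The upperset generated by a finite set. -/
def genU {X : PartOrd.{u}} (s : Set X) (hs : s.Finite) : Uω.obj X :=
  OrderDual.toDual (genL (X := PartOrd.dual.obj X) (OrderDual.ofDual ⁻¹' s)
    (hs.preimage OrderDual.ofDual.injective.injOn))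

theorem memL_genL {X : PartOrd.{u}} (s : Set X) (hs : s.Finite) (x : X) :
    memL x (genL s hs) ↔ ∃ y ∈ s, x ≤ y := Iff.rfl

theorem memU_genU {X : PartOrd.{u}} (s : Set X) (hs : s.Finite) (x : X) :
    memU x (genU s hs) ↔ ∃ y ∈ s, y ≤ x := Iff.rfl

theorem memL_map {X Y : PartOrd.{u}} (f : X ⟶ Y) (l : Lω.obj X) (y : Y) :
    memL y (Lω.map f l) ↔ ∃ x, memL x l ∧ y ≤ f x := by
  constructor
  · rintro ⟨_, ⟨x, hx, rfl⟩, h⟩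
    exact ⟨x, hx, h⟩
  · rintro ⟨x, hx, h⟩
    exact ⟨f x, ⟨x, hx, rfl⟩, h⟩

theorem memU_map {X Y : PartOrd.{u}} (f : X ⟶ Y) (v : Uω.obj X) (y : Y) :
    memU y (Uω.map f v) ↔ ∃ x, memU x v ∧ f x ≤ y :=
  memL_map (PartOrd.dual.map f) (OrderDual.ofDual v) (OrderDual.toDual y)

theorem le_Lω {X : PartOrd.{u}} (l l' : Lω.obj X) :
    l ≤ l' ↔ ∀ x : X, memL x l → memL x l' := Iff.rfl

theorem le_Uω {X : PartOrd.{u}} (v v' : Uω.obj X) :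
    v ≤ v' ↔ ∀ x : X, memU x v' → memU x v := Iff.rfl

/-! ### Colimits of chains of posets -/

theorem exists_rep {J : Type*} [Category J] {D : J ⥤ PartOrd.{u}} {s : Cocone D}
    (hs : IsColimit s) (y : s.pt) : ∃ (j : J) (x : D.obj j), s.ι.app j x = y := by
  let S : Set s.pt := {y | ∃ (j : J) (x : D.obj j), s.ι.app j x = y}
  let i : PartOrd.of S ⟶ s.pt := PartOrd.ofHom ⟨fun x => x.1, fun _ _ h => h⟩
  let c : Cocone D :=
    { pt := PartOrd.of S
      ι :=
        { app := fun j => PartOrd.ofHom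
            ⟨fun x => ⟨s.ι.app j x, j, x, rfl⟩, fun _ _ h => (s.ι.app j).hom.monotone h⟩
          naturality := by
            intro j k f
            ext x
            apply Subtype.ext
            exact ConcreteCategory.congr_hom (s.w f) x } }
  have h : hs.desc c ≫ i = 𝟙 _ := by
    apply hs.hom_ext
    intro j
    rw [← Category.assoc, hs.fac]
    rfl
  have h' := ConcreteCategory.congr_hom h y
  have h2 := (hs.desc c y).2
  change i (hs.desc c y) = y at h'
  rw [← h']
  exact h2

section chain

variable (D : ℕ ⥤ PartOrd.{u})

/-- The transition map of a chain. -/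
abbrev tr {m n : ℕ} (h : m ≤ n) : D.obj m ⟶ D.obj n := D.map (homOfLE h)

theorem tr_tr {k m n : ℕ} (h : k ≤ m) (h' : m ≤ n) (x : D.obj k) :
    tr D h' (tr D h x) = tr D (h.trans h') x := by
  have : tr D (h.trans h') = tr D h ≫ tr D h' := by
    rw [← D.map_comp]; rfl
  rw [this]; rfl

theorem ι_tr {D : ℕ ⥤ PartOrd.{u}} (s : Cocone D) {m n : ℕ} (h : m ≤ n) (x : D.obj m) :
    s.ι.app n (tr D h x) = s.ι.app m x :=
  ConcreteCategory.congr_hom (s.w (homOfLE h)) x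

/-- A cocone under a chain is a colimit as soon as it is jointly surjective and inequalities
between images hold already at some stage. -/
noncomputable def isColimitChain {D : ℕ ⥤ PartOrd.{u}} (s : Cocone D)
    (surj : ∀ y : s.pt, ∃ (n : ℕ) (x : D.obj n), s.ι.app n x = y)
    (refl : ∀ (n : ℕ) (x y : D.obj n), s.ι.app n x ≤ s.ι.app n y →
      ∃ (k : ℕ) (h : n ≤ k), tr D h x ≤ tr D h y) : IsColimit s := by
  choose N r hr using surj
  have key : ∀ (t : Cocone D) (m n : ℕ) (x : D.obj m) (y : D.obj n),
      s.ι.app m x ≤ s.ι.app n y → t.ι.app m x ≤ t.ι.app n y := by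
    intro t m n x y h
    rw [← ι_tr s (le_max_left m n), ← ι_tr s (le_max_right m n)] at h
    obtain ⟨k, hk, h⟩ := refl _ _ _ h
    have := (t.ι.app k).hom.monotone h
    rw [← ι_tr t (le_max_left m n), ← ι_tr t (le_max_right m n), ← ι_tr t hk, ← ι_tr t hk]
    exact this
  refine
    { desc := fun t => PartOrd.ofHom ⟨fun y => t.ι.app (N y) (r y), fun y y' h => ?_⟩
      fac := fun t n => ?_
      uniq := fun t f hf => ?_ }
  · apply key
    rw [hr, hr]
    exact h
  · ext x
    apply le_antisymm
    · exact key t _ _ _ _ (hr _).le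
    · exact key t _ _ _ _ (hr _).ge
  · ext y
    change f y = t.ι.app (N y) (r y)
    rw [← hf]
    change f y = f (s.ι.app (N y) (r y))
    rw [hr]

/-- The disjoint union of a chain. -/
structure ChainElt where
  stage : ℕ
  elt : D.obj stage

/-- The preorder on the disjoint union of a chain: `x` lies eventually below `y`. -/
instance : Preorder (ChainElt D) where
  le x y := ∃ (k : ℕ) (h : x.1 ≤ k) (h' : y.1 ≤ k), tr D h x.2 ≤ tr D h' y.2
  le_refl x := ⟨x.1, le_rfl, le_rfl, le_rfl⟩
  le_trans x y z := by
    rintro ⟨k, h₁, h₂, h⟩ ⟨l, h₃, h₄, h'⟩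
    refine ⟨max k l, h₁.trans (le_max_left _ _), h₄.trans (le_max_right _ _), ?_⟩
    have a := (tr D (le_max_left k l)).hom.monotone h
    have b := (tr D (le_max_right k l)).hom.monotone h'
    change tr D _ (tr D _ _) ≤ tr D _ (tr D _ _) at a
    change tr D _ (tr D _ _) ≤ tr D _ (tr D _ _) at b
    rw [tr_tr, tr_tr] at a b
    exact a.trans b

/-- The colimit cocone of a chain. -/
def chainCocone : Cocone D :=
  { pt := PartOrd.of (Antisymmetrization (ChainElt D) (· ≤ ·))
    ι :=
      { app := fun n => PartOrd.ofHom
          ⟨fun x => toAntisymmetrization (· ≤ ·) (⟨n, x⟩ : ChainElt D), fun x y h =>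
            toAntisymmetrization_mono ⟨n, le_rfl, le_rfl, (tr D le_rfl).hom.monotone h⟩⟩
        naturality := by
          intro m n f
          ext x
          have hf : f = homOfLE (leOfHom f) := rfl
          apply Quotient.sound
          constructor
          · refine ⟨n, le_rfl, leOfHom f, ?_⟩
            change tr D _ (tr D (leOfHom f) x) ≤ _
            rw [tr_tr]
          · refine ⟨n, leOfHom f, le_rfl, ?_⟩
            change _ ≤ tr D _ (tr D (leOfHom f) x)
            rw [tr_tr] } }

theorem chainCocone_refl (n : ℕ) (x y : D.obj n)
    (h : (chainCocone D).ι.app n x ≤ (chainCocone D).ι.app n y) :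
    ∃ (k : ℕ) (h : n ≤ k), tr D h x ≤ tr D h y := by
  obtain ⟨k, h₁, _, h⟩ := h
  exact ⟨k, h₁, h⟩

noncomputable def chainIsColimit : IsColimit (chainCocone D) := by
  refine isColimitChain _ ?_ (chainCocone_refl D)
  intro y
  induction y using Quotient.inductionOn with
  | _ x => exact ⟨x.1, x.2, rfl⟩

instance : HasColimitsOfShape ℕ PartOrd.{u} where
  has_colimit D := ⟨⟨⟨_, chainIsColimit D⟩⟩⟩

theorem colimit_refl {D : ℕ ⥤ PartOrd.{u}} {s : Cocone D} (hs : IsColimit s) (n : ℕ)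
    (x y : D.obj n) (h : s.ι.app n x ≤ s.ι.app n y) :
    ∃ (k : ℕ) (h : n ≤ k), tr D h x ≤ tr D h y := by
  apply chainCocone_refl
  have := (hs.desc (chainCocone D)).hom.monotone h
  have e : ∀ z, hs.desc (chainCocone D) (s.ι.app n z) = (chainCocone D).ι.app n z := fun z =>
    ConcreteCategory.congr_hom (hs.fac (chainCocone D) n) z
  rw [← e, ← e]
  exact this

end chain

theorem exists_stage {D : ℕ ⥤ PartOrd.{u}} {s : Cocone D} (hs : IsColimit s)
    {t : Set s.pt} (ht : t.Finite) : ∃ (n : ℕ) (t' : Set (D.obj n)), t'.Finite ∧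
      s.ι.app n '' t' = t := by
  induction t, ht using Set.Finite.induction_on with
  | empty => exact ⟨0, ∅, Set.finite_empty, Set.image_empty _⟩
  | @insert a t _ _ ih =>
    obtain ⟨n, t', ht', rfl⟩ := ih
    obtain ⟨m, x, rfl⟩ := exists_rep hs a
    refine ⟨max m n, insert (tr D (le_max_left m n) x) (tr D (le_max_right m n) '' t'),
      (ht'.image _).insert _, ?_⟩
    rw [Set.image_insert_eq, Set.image_image, ι_tr]
    congr 1
    exact Set.image_congr fun y _ => ι_tr s _ y

theorem Lω_map_gen {X Y : PartOrd.{u}} (f : X ⟶ Y) (s : Set X) (hs : s.Finite) :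
    Lω.map f (genL s hs) = genL (f '' s) (hs.image _) := by
  apply le_antisymm <;> rw [le_Lω] <;> intro y
  · rw [memL_map, memL_genL]
    rintro ⟨x, ⟨z, hz, hxz⟩, hy⟩
    exact ⟨f z, ⟨z, hz, rfl⟩, hy.trans (f.hom.monotone hxz)⟩
  · rw [memL_map, memL_genL]
    rintro ⟨_, ⟨z, hz, rfl⟩, hy⟩
    exact ⟨z, ⟨z, hz, le_rfl⟩, hy⟩

theorem exists_genL {X : PartOrd.{u}} (l : Lω.obj X) : ∃ s hs, l = genL s hs := by
  obtain ⟨l, s, hs, rfl⟩ := l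
  exact ⟨s, hs, rfl⟩

instance : PreservesColimitsOfShape ℕ Lω.{u} where
  preservesColimit {D} := ⟨fun {s} hs => ⟨by
    apply isColimitChain
    · intro l
      obtain ⟨t, ht, rfl⟩ := exists_genL l
      obtain ⟨n, t', ht', rfl⟩ := exists_stage hs ht
      exact ⟨n, genL t' ht', Lω_map_gen _ _ _⟩
    · intro n l l' h
      obtain ⟨t, ht, rfl⟩ := exists_genL l
      obtain ⟨t', ht', rfl⟩ := exists_genL l'
      replace h : Lω.map (s.ι.app n) (genL t ht) ≤ Lω.map (s.ι.app n) (genL t' ht') := h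
      rw [Lω_map_gen, Lω_map_gen] at h
      have h1 : ∀ x ∈ t, ∃ k, ∃ hk : n ≤ k, ∃ y ∈ t', tr D hk x ≤ tr D hk y := by
        intro x hx
        obtain ⟨_, ⟨y, hy, rfl⟩, hxy⟩ := h ⟨_, ⟨x, hx, rfl⟩, le_rfl⟩
        obtain ⟨k, hk, h⟩ := colimit_refl hs n x y hxy
        exact ⟨k, hk, y, hy, h⟩
      choose! K hK Y hY hXY using h1
      obtain ⟨b, hb⟩ := (ht.image K).bddAbove
      refine ⟨max n b, le_max_left _ _, ?_⟩
      change Lω.map (tr D _) (genL t ht) ≤ Lω.map (tr D _) (genL t' ht')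
      rw [Lω_map_gen, Lω_map_gen, le_Lω]
      rintro z ⟨_, ⟨x, hx, rfl⟩, hz⟩
      refine ⟨_, ⟨Y x, hY x hx, rfl⟩, hz.trans ?_⟩
      have hle : K x ≤ max n b := (hb ⟨x, hx, rfl⟩).trans (le_max_right _ _)
      have := (tr D hle).hom.monotone (hXY x hx)
      change tr D _ (tr D _ _) ≤ tr D _ (tr D _ _) at this
      rwa [tr_tr, tr_tr] at this⟩⟩

instance : PartOrd.dual.{u}.IsEquivalence :=
  inferInstanceAs PartOrd.dualEquiv.functor.IsEquivalence

instance (T : PartOrd.{u} ⥤ PartOrd.{u}) [PreservesFilteredColimits T] :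
    PreservesColimitsOfShape ℕ T :=
  have := preservesSmallestFilteredColimits_of_preservesFilteredColimits T
  inferInstance

/-! ### The language -/

section language

variable (T : PartOrd.{u} ⥤ PartOrd.{u}) (At : PartOrd.{u})

/-- The functor `X ↦ 𝕌_ω X + 𝕃_ω X + T^∂ X + T^∂ X + At` whose initial algebra is the poset of
formulas; the summands are the arities of `⋀`, `⋁`, `∇`, `Δ` and the atoms. -/
def step : PartOrd.{u} ⥤ PartOrd.{u} where
  obj X := PartOrd.of (Uω.obj X ⊕ Lω.obj X ⊕ (dualFunctor T).obj X ⊕ (dualFunctor T).obj X ⊕ At)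
  map f := PartOrd.ofHom
    ⟨Sum.map (Uω.map f) (Sum.map (Lω.map f) (Sum.map ((dualFunctor T).map f)
      (Sum.map ((dualFunctor T).map f) id))), by
        rintro _ _ (h | h)
        · exact Sum.LiftRel.inl ((Uω.map f).hom.monotone h)
        · refine Sum.LiftRel.inr ?_
          rcases h with h | h
          · exact Sum.LiftRel.inl ((Lω.map f).hom.monotone h)
          · refine Sum.LiftRel.inr ?_
            rcases h with h | h
            · exact Sum.LiftRel.inl (((dualFunctor T).map f).hom.monotone h)
            · refine Sum.LiftRel.inr ?_
              rcases h with h | h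
              · exact Sum.LiftRel.inl (((dualFunctor T).map f).hom.monotone h)
              · exact Sum.LiftRel.inr h⟩
  map_id X := by
    ext x
    rcases x with x | x | x | x | x
    · change Sum.inl (Uω.map (𝟙 X) x) = Sum.inl x
      rw [CategoryTheory.Functor.map_id]; rfl
    · change Sum.inr (Sum.inl (Lω.map (𝟙 X) x)) = Sum.inr (Sum.inl x)
      rw [CategoryTheory.Functor.map_id]; rfl
    · change Sum.inr (Sum.inr (Sum.inl ((dualFunctor T).map (𝟙 X) x))) = Sum.inr (Sum.inr (Sum.inl x))
      rw [CategoryTheory.Functor.map_id]; rfl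
    · change Sum.inr (Sum.inr (Sum.inr (Sum.inl ((dualFunctor T).map (𝟙 X) x)))) =
        Sum.inr (Sum.inr (Sum.inr (Sum.inl x)))
      rw [CategoryTheory.Functor.map_id]; rfl
    · rfl
  map_comp f g := by
    ext x
    rcases x with x | x | x | x | x
    · change Sum.inl (Uω.map (f ≫ g) x) = Sum.inl (Uω.map g (Uω.map f x))
      rw [Functor.map_comp]; rfl
    · change Sum.inr (Sum.inl (Lω.map (f ≫ g) x)) = Sum.inr (Sum.inl (Lω.map g (Lω.map f x)))
      rw [Functor.map_comp]; rfl
    · change Sum.inr (Sum.inr (Sum.inl ((dualFunctor T).map (f ≫ g) x))) =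
        Sum.inr (Sum.inr (Sum.inl ((dualFunctor T).map g ((dualFunctor T).map f x))))
      rw [Functor.map_comp]; rfl
    · change Sum.inr (Sum.inr (Sum.inr (Sum.inl ((dualFunctor T).map (f ≫ g) x)))) =
        Sum.inr (Sum.inr (Sum.inr (Sum.inl ((dualFunctor T).map g ((dualFunctor T).map f x)))))
      rw [Functor.map_comp]; rfl
    · rfl

/-- The coproduct injections of `step`. -/
def inConj : Uω ⟶ step T At where
  app _ := PartOrd.ofHom ⟨Sum.inl, Sum.inl_mono⟩

def inDisj : Lω ⟶ step T At where
  app _ := PartOrd.ofHom ⟨fun x => Sum.inr (Sum.inl x), Sum.inr_mono.comp Sum.inl_mono⟩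

def inNabla : dualFunctor T ⟶ step T At where
  app _ := PartOrd.ofHom ⟨fun x => Sum.inr (Sum.inr (Sum.inl x)),
    Sum.inr_mono.comp (Sum.inr_mono.comp Sum.inl_mono)⟩

def inDelta : dualFunctor T ⟶ step T At where
  app _ := PartOrd.ofHom ⟨fun x => Sum.inr (Sum.inr (Sum.inr (Sum.inl x))),
    Sum.inr_mono.comp (Sum.inr_mono.comp (Sum.inr_mono.comp Sum.inl_mono))⟩

def inAtom (X : PartOrd.{u}) : At ⟶ (step T At).obj X :=
  PartOrd.ofHom ⟨fun x => Sum.inr (Sum.inr (Sum.inr (Sum.inr x))),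
    Sum.inr_mono.comp (Sum.inr_mono.comp (Sum.inr_mono.comp Sum.inr_mono))⟩

/-- The stages `W₀ = At`, `Wₙ₊₁ = F Wₙ + At` of the construction of the formulas. -/
def W : ℕ → PartOrd.{u}
  | 0 => At
  | n + 1 => (step T At).obj (W n)

/-- The connecting maps. -/
def w : (n : ℕ) → (W T At n ⟶ W T At (n + 1))
  | 0 => inAtom T At At
  | n + 1 => (step T At).map (w n)

/-- The chain of stages. -/
def chain : ℕ ⥤ PartOrd.{u} := Functor.ofSequence (w T At)

/-- The language: the free algebra on `At` for `𝕌_ω + 𝕃_ω + T^∂ + T^∂`. -/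
noncomputable def Lang : PartOrd.{u} := colimit (chain T At)

/-- The inclusion of a stage into the language. -/
noncomputable def ι (n : ℕ) : W T At n ⟶ Lang T At := colimit.ι (chain T At) n

theorem w_ι (n : ℕ) : w T At n ≫ ι T At (n + 1) = ι T At n := by
  have := colimit.w (chain T At) (homOfLE (Nat.le_add_right n 1))
  rwa [chain, Functor.ofSequence_map_homOfLE_succ] at this

/-- A cocone on the image of the chain of stages from a compatible family of maps. -/
def coconeOf (G : PartOrd.{u} ⥤ PartOrd.{u}) {P : PartOrd.{u}}
    (f : ∀ n, G.obj (W T At n) ⟶ P) (hf : ∀ n, G.map (w T At n) ≫ f (n + 1) = f n) :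
    Cocone (chain T At ⋙ G) where
  pt := P
  ι := NatTrans.ofSequence (fun n => f n) (fun n => by
    refine Eq.trans ?_ ((hf n).trans (Category.comp_id (f n)).symm)
    refine congrArg (fun g => G.map g ≫ f (n + 1)) ?_
    exact Functor.ofSequence_map_homOfLE_succ (w T At) n)

theorem step_comp {G : PartOrd.{u} ⥤ PartOrd.{u}} (i : G ⟶ step T At) {X Y P : PartOrd.{u}}
    (f : X ⟶ Y) (j : (step T At).obj Y ⟶ P) (k : (step T At).obj X ⟶ P)
    (h : (step T At).map f ≫ j = k) : G.map f ≫ i.app Y ≫ j = i.app X ≫ k := by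
  rw [← Category.assoc, i.naturality, Category.assoc, h]

/-- The algebra structure of `Lang` on one summand `G` of the signature. -/
noncomputable def op {G : PartOrd.{u} ⥤ PartOrd.{u}} [PreservesColimitsOfShape ℕ G]
    (i : G ⟶ step T At) : G.obj (Lang T At) ⟶ Lang T At :=
  (isColimitOfPreserves G (colimit.isColimit (chain T At))).desc
    (coconeOf T At G (fun n => i.app (W T At n) ≫ ι T At (n + 1)) (fun n =>
      step_comp T At i (w T At n) _ _ (w_ι T At (n + 1))))

theorem ι_op {G : PartOrd.{u} ⥤ PartOrd.{u}} [PreservesColimitsOfShape ℕ G]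
    (i : G ⟶ step T At) (n : ℕ) :
    G.map (ι T At n) ≫ op T At i = i.app (W T At n) ≫ ι T At (n + 1) :=
  (isColimitOfPreserves G (colimit.isColimit (chain T At))).fac _ n

/-- The atoms as formulas. -/
noncomputable def atom : At ⟶ Lang T At := ι T At 0

/-- The algebra map `fold` on the stages. -/
noncomputable def foldStage {P : PartOrd.{u}} (β : (step T At).obj P ⟶ P) :
    (n : ℕ) → (W T At n ⟶ P)
  | 0 => inAtom T At P ≫ β
  | n + 1 => (step T At).map (foldStage β n) ≫ β

theorem w_foldStage {P : PartOrd.{u}} (β : (step T At).obj P ⟶ P) (n : ℕ) :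
    w T At n ≫ foldStage T At β (n + 1) = foldStage T At β n := by
  induction n with
  | zero => rfl
  | succ n ih =>
    change (step T At).map (w T At n) ≫ (step T At).map (foldStage T At β (n + 1)) ≫ β =
      (step T At).map (foldStage T At β n) ≫ β
    rw [← Category.assoc, ← Functor.map_comp, ih]

/-- The algebra map from the language to an algebra `P` for the signature and the atoms (freeness,
existence part: see `atom_fold` and `op_fold`). -/
noncomputable def fold {P : PartOrd.{u}} (β : (step T At).obj P ⟶ P) : Lang T At ⟶ P :=
  colimit.desc (chain T At) (coconeOf T At (𝟭 _) (foldStage T At β) (w_foldStage T At β))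

theorem ι_fold {P : PartOrd.{u}} (β : (step T At).obj P ⟶ P) (n : ℕ) :
    ι T At n ≫ fold T At β = foldStage T At β n :=
  colimit.ι_desc _ _

theorem atom_fold {P : PartOrd.{u}} (β : (step T At).obj P ⟶ P) :
    atom T At ≫ fold T At β = inAtom T At P ≫ β :=
  ι_fold T At β 0

theorem op_fold {G : PartOrd.{u} ⥤ PartOrd.{u}} [PreservesColimitsOfShape ℕ G]
    (i : G ⟶ step T At) {P : PartOrd.{u}} (β : (step T At).obj P ⟶ P) :
    op T At i ≫ fold T At β = G.map (fold T At β) ≫ i.app P ≫ β := by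
  apply (isColimitOfPreserves G (colimit.isColimit (chain T At))).hom_ext
  intro n
  have h₁ : G.map (ι T At n) ≫ op T At i ≫ fold T At β =
      i.app (W T At n) ≫ foldStage T At β (n + 1) :=
    (congrArg (· ≫ fold T At β) (ι_op T At i n)).trans
      (congrArg (i.app (W T At n) ≫ ·) (ι_fold T At β (n + 1)))
  have h₂ : G.map (ι T At n) ≫ G.map (fold T At β) ≫ i.app P ≫ β =
      i.app (W T At n) ≫ foldStage T At β (n + 1) := by
    rw [← Category.assoc, ← Functor.map_comp, ι_fold]
    exact step_comp T At i _ _ _ rfl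
  exact h₁.trans h₂.symm

/-- Conjunction `⋀ : 𝕌_ω Lang → Lang`. -/
noncomputable def conj : Uω.obj (Lang T At) ⟶ Lang T At := op T At (inConj T At)

/-- Disjunction `⋁ : 𝕃_ω Lang → Lang`. -/
noncomputable def disj : Lω.obj (Lang T At) ⟶ Lang T At := op T At (inDisj T At)

variable [PreservesFilteredColimits T]

/-- The cover modality `∇ : T^∂ Lang → Lang`. -/
noncomputable def nabla : (dualFunctor T).obj (Lang T At) ⟶ Lang T At := op T At (inNabla T At)

/-- The dual modality `Δ : T^∂ Lang → Lang`. -/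
noncomputable def delta : (dualFunctor T).obj (Lang T At) ⟶ Lang T At := op T At (inDelta T At)


/-- Freeness, uniqueness part: an algebra map out of the language is determined by the atoms. -/
theorem fold_unique {P : PartOrd.{u}} (β : (step T At).obj P ⟶ P) (f : Lang T At ⟶ P)
    (hconj : conj T At ≫ f = Uω.map f ≫ (inConj T At).app P ≫ β)
    (hdisj : disj T At ≫ f = Lω.map f ≫ (inDisj T At).app P ≫ β)
    (hnabla : nabla T At ≫ f = (dualFunctor T).map f ≫ (inNabla T At).app P ≫ β)
    (hdelta : delta T At ≫ f = (dualFunctor T).map f ≫ (inDelta T At).app P ≫ β)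
    (hatom : atom T At ≫ f = inAtom T At P ≫ β) : f = fold T At β := by
  have key : ∀ {G : PartOrd.{u} ⥤ PartOrd.{u}} [PreservesColimitsOfShape ℕ G]
      (i : G ⟶ step T At), op T At i ≫ f = G.map f ≫ i.app P ≫ β →
      ∀ n, ι T At n ≫ f = foldStage T At β n →
      i.app (W T At n) ≫ ι T At (n + 1) ≫ f = i.app (W T At n) ≫ foldStage T At β (n + 1) := by
    intro G _ i h n hn
    have h₂ : G.map (ι T At n) ≫ op T At i ≫ f = i.app (W T At n) ≫ foldStage T At β (n + 1) := by
      rw [h, ← Category.assoc, ← Functor.map_comp, hn]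
      exact step_comp T At i _ _ _ rfl
    exact (congrArg (· ≫ f) (ι_op T At i n)).symm.trans h₂
  have hn : ∀ n, ι T At n ≫ f = foldStage T At β n := by
    intro n
    induction n with
    | zero => exact hatom
    | succ n ih =>
      ext x
      rcases x with x | x | x | x | p
      · exact ConcreteCategory.congr_hom (key (inConj T At) hconj n ih) x
      · exact ConcreteCategory.congr_hom (key (inDisj T At) hdisj n ih) x
      · exact ConcreteCategory.congr_hom (key (inNabla T At) hnabla n ih) x
      · exact ConcreteCategory.congr_hom (key (inDelta T At) hdelta n ih) x
      · have e : ∀ m, inAtom T At (W T At m) ≫ ι T At (m + 1) = atom T At := by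
          intro m
          induction m with
          | zero => exact w_ι T At 0
          | succ m ih' =>
            rw [← ih', ← w_ι T At (m + 1)]
            rfl
        have := (congrArg (· ≫ f) (e n)).trans hatom
        exact ConcreteCategory.congr_hom this p
  apply colimit.hom_ext
  intro n
  exact (hn n).trans (ι_fold T At β n).symm

end language

/-! ### Semantics -/

section semantics

variable (T : PartOrd.{u} ⥤ PartOrd.{u}) (At : PartOrd.{u})

/-- The poset of uppersets (truth sets) of `X`, as monotone maps to `Prop`. -/
def Up (X : PartOrd.{u}) : PartOrd.{u} := PartOrd.of (X →o Prop)

/-- `x ∈ A`, as a monotone relation `Up X ⇸ Xᵒᵖ`. -/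
def holds {X L : PartOrd.{u}} (f : L ⟶ Up X) : MRel L (PartOrd.dual.obj X) where
  rel x a := (show X →o Prop from f a) (OrderDual.ofDual x)
  mono := by
    intro y y' a a' h hy ha
    exact (f.hom.monotone ha) _ ((show X →o Prop from f a).monotone hy h)

/-- `x ∉ A`, as a monotone relation `(Up X)ᵒᵖ ⇸ X`. -/
def fails {X L : PartOrd.{u}} (f : L ⟶ Up X) : MRel (PartOrd.dual.obj L) X where
  rel x a := ¬ (show X →o Prop from f (OrderDual.ofDual a)) x
  mono := by
    intro y y' a a' h hy ha h'
    exact h ((f.hom.monotone ha) _ ((show X →o Prop from f (OrderDual.ofDual a')).monotone hy h'))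

/-- An element of `T X`, seen as an element of `T^∂ Xᵒᵖ = (T Xᵒᵖᵒᵖ)ᵒᵖ`. -/
def toTDual {X : PartOrd.{u}} (t : T.obj X) : (dualFunctor T).obj (PartOrd.dual.obj X) :=
  OrderDual.toDual (T.map (PartOrd.Iso.mk (OrderIso.dualDual X)).hom t)

variable {T At}

/-- The interpretation of the connectives, modalities and atoms on truth sets. -/
def semAlg {X : PartOrd.{u}} (c : X ⟶ T.obj X) (V : MRel At (PartOrd.dual.obj X)) :
    (step T At).obj (Up X) ⟶ Up X :=
  PartOrd.ofHom (X := Uω.obj (Up X) ⊕ Lω.obj (Up X) ⊕ (dualFunctor T).obj (Up X) ⊕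
      (dualFunctor T).obj (Up X) ⊕ At) (Y := X →o Prop)
    { toFun := fun
        | .inl v => ⟨fun x => ∀ A : Up X, memU A v → (show X →o Prop from A) x,
            fun x y h hx A hA => (show X →o Prop from A).monotone h (hx A hA)⟩
        | .inr (.inl l) => ⟨fun x => ∃ A : Up X, memL A l ∧ (show X →o Prop from A) x,
            fun x y h ⟨A, hA, hx⟩ => ⟨A, hA, (show X →o Prop from A).monotone h hx⟩⟩
        | .inr (.inr (.inl α)) => ⟨fun x => (lift (dualFunctor T) (holds (𝟙 (Up X)))).rel
            (toTDual T (c x)) α, fun x y h hx => (lift (dualFunctor T) (holds (𝟙 (Up X)))).mono hx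
              ((T.map _).hom.monotone (c.hom.monotone h)) le_rfl⟩
        | .inr (.inr (.inr (.inl α))) => ⟨fun x => ¬ (lift T (fails (𝟙 (Up X)))).rel
            (c x) (OrderDual.ofDual α), fun x y h hx hy => hx
              ((lift T (fails (𝟙 (Up X)))).mono hy (c.hom.monotone h) le_rfl)⟩
        | .inr (.inr (.inr (.inr p))) => ⟨fun x => V.rel (OrderDual.toDual x) p,
            fun x y h hx => V.mono hx h le_rfl⟩
      monotone' := by
        rintro _ _ (h | h)
        · exact fun x hx A hA => hx A (h hA)
        · rcases h with h | h
          · exact fun x ⟨A, hA, hx⟩ => ⟨A, h hA, hx⟩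
          · rcases h with h | h
            · exact fun x hx => (lift (dualFunctor T) (holds (𝟙 (Up X)))).mono hx le_rfl h
            · rcases h with h | h
              · exact fun x hx hy => hx ((lift T (fails (𝟙 (Up X)))).mono hy le_rfl h)
              · exact fun x hx => V.mono hx le_rfl h }

/-- The truth set of a formula. -/
noncomputable def truth {X : PartOrd.{u}} (c : X ⟶ T.obj X) (V : MRel At (PartOrd.dual.obj X)) :
    Lang T At ⟶ Up X :=
  fold T At (semAlg c V)

/-- The semantics relation `⊩ : Lang ⇸ Xᵒᵖ`. -/
noncomputable def sat {X : PartOrd.{u}} (c : X ⟶ T.obj X) (V : MRel At (PartOrd.dual.obj X)) :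
    MRel (Lang T At) (PartOrd.dual.obj X) :=
  holds (truth c V)

/-- The negated semantics relation `⊮ : Langᵒᵖ ⇸ X`. -/
noncomputable def nsat {X : PartOrd.{u}} (c : X ⟶ T.obj X) (V : MRel At (PartOrd.dual.obj X)) :
    MRel (PartOrd.dual.obj (Lang T At)) X :=
  fails (truth c V)

/-- `x ⊩ a`. -/
def Sat {X : PartOrd.{u}} (c : X ⟶ T.obj X) (V : MRel At (PartOrd.dual.obj X)) (x : X)
    (a : Lang T At) : Prop :=
  (sat c V).rel (OrderDual.toDual x) a

theorem nsat_rel {X : PartOrd.{u}} (c : X ⟶ T.obj X) (V : MRel At (PartOrd.dual.obj X)) (x : X)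
    (a : Lang T At) : (nsat c V).rel x (OrderDual.toDual a) ↔ ¬ Sat c V x a := Iff.rfl

/-- Relation lifting commutes with restriction along a map of domains. -/
theorem lift_restrict (hT : PreservesExactSquares T) {A X Y : PartOrd.{u}} (R : MRel X Y)
    (S : MRel A Y) (f : A ⟶ X) (h : ∀ y a, S.rel y a ↔ R.rel y (f a)) (b : T.obj Y)
    (a : T.obj A) : (lift T S).rel b a ↔ (lift T R).rel b (T.map f a) := by
  let g : S.graph ⟶ R.graph := PartOrd.ofHom
    ⟨fun p => ⟨(p.1.1, f p.1.2), (h _ _).1 p.2⟩, fun p q hpq => ⟨hpq.1, f.hom.monotone hpq.2⟩⟩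
  have e₀ : S.p₀ = g ≫ R.p₀ := rfl
  have e₁ : g ≫ R.p₁ = S.p₁ ≫ f := rfl
  have sq : ExactSquare g S.p₁ R.p₁ f := by
    refine ⟨fun w => le_rfl, ?_⟩
    rintro ⟨⟨y, x⟩, hyx⟩ a hxa
    exact ⟨⟨(y, a), (h _ _).2 (R.mono hyx le_rfl hxa)⟩, ⟨le_rfl, hxa⟩, le_rfl⟩
  constructor
  · rintro ⟨t, h₀, h₁⟩
    refine ⟨T.map g t, ?_, ?_⟩
    · rw [e₀, T.map_comp] at h₀
      exact h₀
    · have : T.map R.p₁ (T.map g t) = T.map f (T.map S.p₁ t) := by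
        change (T.map g ≫ T.map R.p₁) t = (T.map S.p₁ ≫ T.map f) t
        rw [← T.map_comp, ← T.map_comp, e₁]
      rw [this]
      exact (T.map f).hom.monotone h₁
  · rintro ⟨t, h₀, h₁⟩
    obtain ⟨s, hs₀, hs₁⟩ := (hT _ _ _ _ sq).2 t a h₁
    refine ⟨s, ?_, hs₁⟩
    rw [e₀, T.map_comp]
    exact h₀.trans ((T.map R.p₀).hom.monotone hs₀)

/-- The dual functor preserves exact squares as well. -/
theorem PreservesExactSquares.dual (hT : PreservesExactSquares T) :
    PreservesExactSquares (dualFunctor T) := by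
  intro P A B C p₀ p₁ f g h
  have := hT (PartOrd.dual.map p₁) (PartOrd.dual.map p₀) (PartOrd.dual.map g) (PartOrd.dual.map f)
    ⟨h.1, fun a b hab => by
      obtain ⟨w, h₁, h₂⟩ := h.2 _ _ hab
      exact ⟨w, h₂, h₁⟩⟩
  refine ⟨this.1, fun a b hab => ?_⟩
  obtain ⟨w, h₁, h₂⟩ := this.2 _ _ hab
  exact ⟨w, h₂, h₁⟩

section clauses

variable {X : PartOrd.{u}} (c : X ⟶ T.obj X) (V : MRel At (PartOrd.dual.obj X)) (x : X)

theorem sat_atom (p : At) : Sat c V x (atom T At p) ↔ V.rel (OrderDual.toDual x) p := by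
  have := ConcreteCategory.congr_hom (atom_fold T At (semAlg c V)) p
  exact iff_of_eq (DFunLike.congr_fun (F := X →o Prop) this x)

theorem sat_conj (v : Uω.obj (Lang T At)) :
    Sat c V x (conj T At v) ↔ ∀ a : Lang T At, memU a v → Sat c V x a := by
  have := ConcreteCategory.congr_hom (op_fold T At (inConj T At) (semAlg c V)) v
  refine (iff_of_eq (DFunLike.congr_fun (F := X →o Prop) this x)).trans ?_
  constructor
  · intro h a ha
    exact h _ ((memU_map (truth c V) v _).2 ⟨a, ha, le_rfl⟩)
  · intro h A hA
    obtain ⟨a, ha, hle⟩ := (memU_map (truth c V) v _).1 hA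
    exact hle _ (h a ha)

theorem sat_disj (l : Lω.obj (Lang T At)) :
    Sat c V x (disj T At l) ↔ ∃ a : Lang T At, memL a l ∧ Sat c V x a := by
  have := ConcreteCategory.congr_hom (op_fold T At (inDisj T At) (semAlg c V)) l
  refine (iff_of_eq (DFunLike.congr_fun (F := X →o Prop) this x)).trans ?_
  constructor
  · rintro ⟨A, hA, hx⟩
    obtain ⟨a, ha, hle⟩ := (memL_map (truth c V) l _).1 hA
    exact ⟨a, ha, hle _ hx⟩
  · rintro ⟨a, ha, hx⟩
    exact ⟨_, (memL_map (truth c V) l _).2 ⟨a, ha, le_rfl⟩, hx⟩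

variable [PreservesFilteredColimits T]

theorem sat_nabla (hT : PreservesExactSquares T) (α : (dualFunctor T).obj (Lang T At)) :
    Sat c V x (nabla T At α) ↔ (lift (dualFunctor T) (sat c V)).rel (toTDual T (c x)) α := by
  have := ConcreteCategory.congr_hom (op_fold T At (inNabla T At) (semAlg c V)) α
  refine (iff_of_eq (DFunLike.congr_fun (F := X →o Prop) this x)).trans ?_
  exact (lift_restrict hT.dual (holds (𝟙 (Up X))) (sat c V) (truth c V)
    (fun _ _ => Iff.rfl) _ _).symm

theorem sat_delta (hT : PreservesExactSquares T) (α : (dualFunctor T).obj (Lang T At)) :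
    ¬ Sat c V x (delta T At α) ↔ (lift T (nsat c V)).rel (c x) (OrderDual.ofDual α) := by
  have := ConcreteCategory.congr_hom (op_fold T At (inDelta T At) (semAlg c V)) α
  refine (not_congr (iff_of_eq (DFunLike.congr_fun (F := X →o Prop) this x))).trans ?_
  refine not_not.trans ?_
  exact (lift_restrict hT (fails (𝟙 (Up X))) (nsat c V) (PartOrd.dual.map (truth c V))
    (fun _ _ => Iff.rfl) _ _).symm

end clauses

/-- Semantic equivalence `a ≡ b`. -/
def SemEquiv (a b : Lang T At) : Prop :=
  ∀ (X : PartOrd.{u}) (c : X ⟶ T.obj X) (V : MRel At (PartOrd.dual.obj X)) (x : X),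
    Sat c V x a ↔ Sat c V x b

end semantics

/-! ### Bases and the collection `R_α` -/

/-- The inclusion of a subposet. -/
def incl {Y : PartOrd.{u}} (S : Set Y) : PartOrd.of S ⟶ Y :=
  PartOrd.ofHom ⟨fun x => x.1, fun _ _ h => h⟩

/-- The base of an element `α` of `G Y`: the intersection of all subposets `S` of `Y` such that
`α` belongs to the subobject `G S` of `G Y`. -/
def base (G : PartOrd.{u} ⥤ PartOrd.{u}) {Y : PartOrd.{u}} (α : G.obj Y) : Set Y :=
  ⋂₀ {S : Set Y | ∃ a, G.map (incl S) a = α}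

/-- The diagram of the finite subposets of `Y`. -/
def finSub (Y : PartOrd.{u}) : Finset Y ⥤ PartOrd.{u} where
  obj S := PartOrd.of {x : Y // x ∈ S}
  map f := PartOrd.ofHom ⟨fun x => ⟨x.1, leOfHom f x.2⟩, fun _ _ h => h⟩

def finSubCocone (Y : PartOrd.{u}) : Cocone (finSub Y) where
  pt := Y
  ι := { app := fun S => PartOrd.ofHom ⟨fun x => x.1, fun _ _ h => h⟩ }

/-- Every poset is the filtered colimit of its finite subposets. -/
def finSubIsColimit (Y : PartOrd.{u}) : IsColimit (finSubCocone Y) := by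
  have key : ∀ (t : Cocone (finSub Y)) (S S' : Finset Y) (x : Y) (h : x ∈ S) (h' : x ∈ S'),
      S ⊆ S' → t.ι.app S ⟨x, h⟩ = t.ι.app S' ⟨x, h'⟩ := fun t S S' x h h' hS =>
    (ConcreteCategory.congr_hom (t.w (homOfLE hS)) ⟨x, h⟩).symm
  refine
    { desc := fun t => PartOrd.ofHom
        ⟨fun x => t.ι.app {x} ⟨x, Finset.mem_singleton_self x⟩, fun x y h => ?_⟩
      fac := fun t S => ?_
      uniq := fun t f hf => ?_ }
  · classical
    change t.ι.app {x} ⟨x, _⟩ ≤ t.ι.app {y} ⟨y, _⟩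
    rw [key t {x} {x, y} x _ (by simp) (by simp), key t {y} {x, y} y _ (by simp) (by simp)]
    exact (t.ι.app {x, y}).hom.monotone h
  · refine PartOrd.ext fun x => ?_
    exact key t {x.1} S x.1 _ x.2 (by simpa using x.2)
  · refine PartOrd.ext fun x => ?_
    change f x = t.ι.app {x} ⟨x, _⟩
    rw [← hf]
    rfl

theorem base_spec_aux (G : PartOrd.{u} ⥤ PartOrd.{u}) [PreservesFilteredColimits G]
    (hG : PreservesFiniteIntersections G) {Y : PartOrd.{u}} (α : G.obj Y) :
    (base G α).Finite ∧ ∃ a, G.map (incl (base G α)) a = α := by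
  classical
  have up : ∀ S S' : Set Y, S ⊆ S' → (∃ a, G.map (incl S) a = α) → ∃ a, G.map (incl S') a = α := by
    rintro S S' h ⟨a, rfl⟩
    let j : PartOrd.of S ⟶ PartOrd.of S' := PartOrd.ofHom ⟨fun x => ⟨x.1, h x.2⟩, fun _ _ h => h⟩
    refine ⟨G.map j a, ?_⟩
    change (G.map j ≫ G.map (incl S')) a = _
    rw [← G.map_comp]
    rfl
  have inter : ∀ S S' : Set Y, (∃ a, G.map (incl S) a = α) → (∃ a, G.map (incl S') a = α) →
      ∃ a, G.map (incl (S ∩ S')) a = α := by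
    rintro S S' ⟨a, ha⟩ ⟨b, hb⟩
    let p : PartOrd.of (S ∩ S' : Set Y) ⟶ PartOrd.of S :=
      PartOrd.ofHom ⟨fun x => ⟨x.1, x.2.1⟩, fun _ _ h => h⟩
    let q : PartOrd.of (S ∩ S' : Set Y) ⟶ PartOrd.of S' :=
      PartOrd.ofHom ⟨fun x => ⟨x.1, x.2.2⟩, fun _ _ h => h⟩
    have hpb : IsPullback p q (incl S) (incl S') := by
      refine ⟨⟨rfl⟩, ⟨PullbackCone.IsLimit.mk _ (fun s => PartOrd.ofHom
        ⟨fun x => ⟨(s.fst x).1, (s.fst x).2, ?_⟩, fun x y h => s.fst.hom.monotone h⟩)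
        (fun s => rfl) (fun s => ?_) (fun s m h₁ h₂ => ?_)⟩⟩
      · have : (s.fst x).1 = (s.snd x).1 := ConcreteCategory.congr_hom s.condition x
        rw [this]
        exact (s.snd x).2
      · refine PartOrd.ext fun x => Subtype.ext ?_
        exact ConcreteCategory.congr_hom s.condition x
      · refine PartOrd.ext fun x => Subtype.ext ?_
        have e : p (m x) = s.fst x := ConcreteCategory.congr_hom h₁ x
        exact congrArg (fun z : S => z.1) e
    have hG' := hG p q (incl S) (incl S') (fun _ _ h => h) (fun _ _ h => h) hpb
    let f : PartOrd.of PUnit.{u + 1} ⟶ G.obj (PartOrd.of S) :=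
      PartOrd.ofHom ⟨fun _ => a, fun _ _ _ => le_rfl⟩
    let g : PartOrd.of PUnit.{u + 1} ⟶ G.obj (PartOrd.of S') :=
      PartOrd.ofHom ⟨fun _ => b, fun _ _ _ => le_rfl⟩
    have hfg : f ≫ G.map (incl S) = g ≫ G.map (incl S') :=
      PartOrd.ext fun _ => ha.trans hb.symm
    refine ⟨hG'.lift f g hfg PUnit.unit, ?_⟩
    have e : G.map (incl (S ∩ S')) = G.map p ≫ G.map (incl S) := by
      rw [← G.map_comp]; rfl
    rw [e]
    have := ConcreteCategory.congr_hom (hG'.lift_fst f g hfg) PUnit.unit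
    change G.map (incl S) (G.map p (hG'.lift f g hfg PUnit.unit)) = α
    change G.map p (hG'.lift f g hfg PUnit.unit) = a at this
    rw [this, ha]
  have ex : ∃ n : ℕ, ∃ S : Finset Y, S.card = n ∧ ∃ a, G.map (incl (S : Set Y)) a = α := by
    obtain ⟨S, a, ha⟩ := exists_rep (isColimitOfPreserves G (finSubIsColimit Y)) α
    exact ⟨_, S, rfl, a, ha⟩
  obtain ⟨S, hS, hα⟩ := Nat.find_spec ex
  have hmin : ∀ S' : Set Y, (∃ a, G.map (incl S') a = α) → (S : Set Y) ⊆ S' := by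
    intro S' h'
    have h := inter _ _ hα h'
    have hsub : S.filter (· ∈ S') ⊆ S := Finset.filter_subset _ _
    have hcoe : ((S.filter (· ∈ S') : Finset Y) : Set Y) = (S : Set Y) ∩ S' := by
      ext; simp
    rw [← hcoe] at h
    have hle := Nat.find_min' ex ⟨_, rfl, h⟩
    have := Finset.eq_of_subset_of_card_le hsub (hS.le.trans hle)
    intro x hx
    rw [Finset.mem_coe, ← this] at hx
    exact (Finset.mem_filter.1 hx).2
  have hb : base G α = S := Set.Subset.antisymm (Set.sInter_subset_of_mem hα)
    (Set.subset_sInter hmin)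
  rw [hb]
  exact ⟨S.finite_toSet, hα⟩

/-- The base is finite, and it is characterised by its universal property: it is contained in `S`
if and only if `α` belongs to `G S`. -/
theorem base_spec (G : PartOrd.{u} ⥤ PartOrd.{u}) [PreservesFilteredColimits G]
    (hG : PreservesFiniteIntersections G) {Y : PartOrd.{u}} (α : G.obj Y) :
    (base G α).Finite ∧ ∀ S : Set Y, base G α ⊆ S ↔ ∃ a, G.map (incl S) a = α := by
  obtain ⟨h, a, ha⟩ := base_spec_aux G hG α
  refine ⟨h, fun S => ⟨fun hS => ?_, fun hS => Set.sInter_subset_of_mem hS⟩⟩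
  let j : PartOrd.of (base G α) ⟶ PartOrd.of S :=
    PartOrd.ofHom ⟨fun x => ⟨x.1, hS x.2⟩, fun _ _ h => h⟩
  refine ⟨G.map j a, ?_⟩
  refine Eq.trans ?_ ha
  change (G.map j ≫ G.map (incl S)) a = _
  rw [← G.map_comp]
  rfl

theorem PreservesFiniteIntersections.dual {T : PartOrd.{u} ⥤ PartOrd.{u}}
    (hT : PreservesFiniteIntersections T) : PreservesFiniteIntersections (dualFunctor T) := by
  intro P A B X p q m n hm hn h
  have h' := hT (PartOrd.dual.map p) (PartOrd.dual.map q) (PartOrd.dual.map m) (PartOrd.dual.map n)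
    (fun x y => hm y x) (fun x y => hn y x) (h.map PartOrd.dual)
  exact h'.map PartOrd.dual

/-- Non-membership `∉ : (𝕃_ω X)ᵒᵖ ⇸ Xᵒᵖ`. -/
def notMem (X : PartOrd.{u}) : MRel (PartOrd.dual.obj (Lω.obj X)) (PartOrd.dual.obj X) where
  rel x l := ¬ memL (X := X) (OrderDual.ofDual x) (OrderDual.ofDual l)
  mono := by
    intro x x' l l' h hx hl h'
    exact h (LowerSet.lower _ hx (hl h'))

/-- The relation `α ¬T̄(∉) Ψ` between `α` in `T^∂ X` and `Ψ` in `T^∂ 𝕃_ω X`. -/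
def notLiftNotMem (T : PartOrd.{u} ⥤ PartOrd.{u}) {X : PartOrd.{u}}
    (α : (dualFunctor T).obj X) (Ψ : (dualFunctor T).obj (Lω.obj X)) : Prop :=
  ¬ (lift T (notMem X)).rel (OrderDual.ofDual α) (OrderDual.ofDual Ψ)

/-- The inclusion `T^∂ 𝕃_ω (base α) → T^∂ 𝕃_ω Y`. -/
def inclBase (T : PartOrd.{u} ⥤ PartOrd.{u}) {Y : PartOrd.{u}} (α : (dualFunctor T).obj Y) :
    (dualFunctor T).obj (Lω.obj (PartOrd.of (base (dualFunctor T) α))) ⟶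
      (dualFunctor T).obj (Lω.obj Y) :=
  (dualFunctor T).map (Lω.map (incl (base (dualFunctor T) α)))

/-- The collection `R_α` of all `Ψ` in `T^∂ 𝕃_ω (base α)` with `α ¬T̄(∉) Ψ`. -/
def R (T : PartOrd.{u} ⥤ PartOrd.{u}) {Y : PartOrd.{u}} (α : (dualFunctor T).obj Y) :
    Set ((dualFunctor T).obj (Lω.obj (PartOrd.of (base (dualFunctor T) α)))) :=
  {Ψ | notLiftNotMem T α (inclBase T α Ψ)}

/-- The formula `Δ(T^∂⋁)Ψ`. -/
noncomputable def deltaDisj (T : PartOrd.{u} ⥤ PartOrd.{u}) (At : PartOrd.{u})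
    [PreservesFilteredColimits T] (Ψ : (dualFunctor T).obj (Lω.obj (Lang T At))) : Lang T At :=
  delta T At ((dualFunctor T).map (disj T At) Ψ)

/-- The conjunction of a finite set of formulas. -/
noncomputable def bigConj (T : PartOrd.{u} ⥤ PartOrd.{u}) (At : PartOrd.{u})
    (s : Set (Lang T At)) (hs : s.Finite) : Lang T At :=
  conj T At (genU s hs)

end MossLogic

namespace MossLogic

/-! ### Calculus of relation lifting. -/

section lifting

variable {T : PartOrd.{u} ⥤ PartOrd.{u}}

/-! Both modalities are brought to liftings by `T` itself: `∇α` holds at `x` iff the lifting of the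
relation "`b` holds at `y`" relates `α` to `c x` (`sat_nabla_iff`), and `Δ(T^∂⋁)Ψ` fails at `x` iff
the lifting of "`⋁ l` fails at `y`" relates `c x` to `Ψ` (`not_sat_deltaDisj_iff`).

If `b` holds at `y` and `⋁ l` fails at `y`, then `b ∉ l`. Liftings compose (`lift_comp`), so if `∇α`
holds and `Δ(T^∂⋁)Ψ` fails at `x`, then the lifted `∉` relates `α` to `Ψ`. This gives the forward
implication for every `Ψ` (`sat_deltaDisj_of_sat_nabla`).

Conversely, a single `Ψ` refutes the right-hand side whenever `∇α` fails. The base `B` of `α` is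
finite, so sending a state `y` to the lowerset of formulas in `B` that fail at `y` is a monotone map
into `(𝕃_ω B)ᵒᵖ`; `Ψ` is the image of `c x` under `T` of this map. The disjunction of the formulas
failing at `y` fails at `y`, so `Δ(T^∂⋁)Ψ` fails at `x` (`lift_map`). For `b` in `B`, not belonging
to the lowerset of `y` means holding at `y`. As `α` comes from `T^∂ B`, a lifted `∉` between `α` and
`Ψ` would therefore give `∇α` at `x`; hence `Ψ` lies in `R T α` (`exists_not_sat_deltaDisj`). Since
this `Ψ` lives over the base, it serves both statements. -/

theorem map_map {X Y Z : PartOrd.{u}} (f : X ⟶ Y) (g : Y ⟶ Z) (h : X ⟶ Z) (e : f ≫ g = h)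
    (t : T.obj X) : T.map g (T.map f t) = T.map h t := by
  rw [← e, T.map_comp]
  rfl

/-- Relation lifting commutes with restriction along a map of codomains. -/
theorem lift_corestrict (hT : PreservesExactSquares T) {B X Y : PartOrd.{u}} (R : MRel X Y)
    (S : MRel X B) (f : B ⟶ Y) (h : ∀ b x, S.rel b x ↔ R.rel (f b) x) (b : T.obj B)
    (a : T.obj X) : (lift T S).rel b a ↔ (lift T R).rel (T.map f b) a := by
  let g : S.graph ⟶ R.graph := PartOrd.ofHom
    ⟨fun p => ⟨(f p.1.1, p.1.2), (h _ _).1 p.2⟩, fun p q hpq => ⟨f.hom.monotone hpq.1, hpq.2⟩⟩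
  have e₀ : g ≫ R.p₀ = S.p₀ ≫ f := rfl
  have e₁ : g ≫ R.p₁ = S.p₁ := rfl
  -- Relations are closed downwards in the codomain variable: from `f b ≤ y` and `(y, x)` in `R`,
  -- the pair `(f b, x)` is in `R`, so `(b, x)` is in `S` and lies over both data.
  have sq : ExactSquare S.p₀ g f R.p₀ := by
    refine ⟨fun w => le_rfl, ?_⟩
    rintro b ⟨⟨y, x⟩, hyx⟩ hby
    exact ⟨⟨(b, x), (h _ _).2 (R.mono hyx hby le_rfl)⟩, le_rfl, hby, le_rfl⟩
  constructor
  · rintro ⟨t, h₀, h₁⟩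
    refine ⟨T.map g t, ?_, ?_⟩
    · rw [map_map g R.p₀ _ e₀, ← map_map S.p₀ f _ rfl]
      exact (T.map f).hom.monotone h₀
    · rw [map_map g R.p₁ _ e₁]
      exact h₁
  · rintro ⟨t, h₀, h₁⟩
    obtain ⟨s, hs₀, hs₁⟩ := (hT _ _ _ _ sq).2 b t h₀
    refine ⟨s, hs₀, ?_⟩
    rw [← map_map g R.p₁ _ e₁]
    exact ((T.map R.p₁).hom.monotone hs₁).trans h₁

/-- Relation lifting is compatible with composition of relations. -/
theorem lift_comp (hT : PreservesExactSquares T) {X Y Z : PartOrd.{u}} (R : MRel X Y)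
    (S : MRel Y Z) (Q : MRel X Z) (h : ∀ z y x, S.rel z y → R.rel y x → Q.rel z x)
    {c : T.obj Z} {b : T.obj Y} {a : T.obj X} (hS : (lift T S).rel c b)
    (hR : (lift T R).rel b a) : (lift T Q).rel c a := by
  obtain ⟨s, hs₀, hs₁⟩ := hS
  obtain ⟨r, hr₀, hr₁⟩ := hR
  -- The comma object of `S.p₁` and `R.p₀` consists of composable pairs up to `≤`; its square is
  -- exact by construction. Monotonicity of `R` makes the middle points agree, which gives the map
  -- `g` into `Q`.
  let P : PartOrd.{u} := PartOrd.of {p : S.graph × R.graph // S.p₁ p.1 ≤ R.p₀ p.2}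
  let q₀ : P ⟶ S.graph := PartOrd.ofHom ⟨fun p => p.1.1, fun _ _ h => h.1⟩
  let q₁ : P ⟶ R.graph := PartOrd.ofHom ⟨fun p => p.1.2, fun _ _ h => h.2⟩
  let g : P ⟶ Q.graph := PartOrd.ofHom
    ⟨fun p => ⟨(p.1.1.1.1, p.1.2.1.2), h _ _ _ p.1.1.2 (R.mono p.1.2.2 p.2 le_rfl)⟩,
      fun _ _ h => ⟨h.1.1, h.2.2⟩⟩
  have sq : ExactSquare q₀ q₁ S.p₁ R.p₀ :=
    ⟨fun p => p.2, fun s r hsr => ⟨⟨(s, r), hsr⟩, le_rfl, le_rfl⟩⟩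
  -- The element `v` projects to `s` and `r` only up to inequality, but in the directions that the
  -- lifting requires.
  obtain ⟨v, hv₀, hv₁⟩ := (hT _ _ _ _ sq).2 s r (hs₁.trans hr₀)
  refine ⟨T.map g v, ?_, ?_⟩
  · rw [map_map g Q.p₀ (q₀ ≫ S.p₀) rfl, ← map_map q₀ S.p₀ _ rfl]
    exact hs₀.trans ((T.map S.p₀).hom.monotone hv₀)
  · rw [map_map g Q.p₁ (q₁ ≫ R.p₁) rfl, ← map_map q₁ R.p₁ _ rfl]
    exact ((T.map R.p₁).hom.monotone hv₁).trans hr₁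

/-- The lifting of a relation is inhabited along the graph of a function contained in it. -/
theorem lift_map {X Y : PartOrd.{u}} (R : MRel Y X) (f : X ⟶ Y) (h : ∀ x, R.rel x (f x))
    (t : T.obj X) : (lift T R).rel t (T.map f t) := by
  let g : X ⟶ R.graph := PartOrd.ofHom
    ⟨fun x => ⟨(x, f x), h x⟩, fun _ _ hxy => ⟨hxy, f.hom.monotone hxy⟩⟩
  refine ⟨T.map g t, ?_, ?_⟩
  · rw [map_map g R.p₀ (𝟙 X) rfl, T.map_id]
    exact le_rfl
  · rw [map_map g R.p₁ f rfl]

/-- The lifting of a relation by `T^∂` is the lifting of the converse relation by `T`. -/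
theorem lift_dualFunctor {X Y : PartOrd.{u}} (R : MRel Y (PartOrd.dual.obj X))
    (S : MRel X (PartOrd.dual.obj Y))
    (h : ∀ (x : X) (y : Y), R.rel (OrderDual.toDual x) y ↔ S.rel (OrderDual.toDual y) x)
    (t : T.obj X) (α : (dualFunctor T).obj Y) :
    (lift (dualFunctor T) R).rel (toTDual T t) α ↔ (lift T S).rel (OrderDual.ofDual α) t := by
  let α' : T.obj (PartOrd.dual.obj Y) := OrderDual.ofDual α
  -- The identification of `X` with its double dual, applied by `toTDual`, and its inverse.
  let d : X ⟶ PartOrd.dual.obj (PartOrd.dual.obj X) := (PartOrd.Iso.mk (OrderIso.dualDual X)).hom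
  let d' : PartOrd.dual.obj (PartOrd.dual.obj X) ⟶ X := (PartOrd.Iso.mk (OrderIso.dualDual X)).inv
  -- Swapping coordinates identifies the dual of the tabulation of `R` with the tabulation of `S`;
  -- `f` and `g` are the two directions, so witnesses can be transported without exactness.
  let f : PartOrd.dual.obj R.graph ⟶ S.graph := PartOrd.ofHom
    ⟨fun p => ⟨(OrderDual.toDual (OrderDual.ofDual p).1.2,
      OrderDual.ofDual (OrderDual.ofDual p).1.1), (h _ _).1 (OrderDual.ofDual p).2⟩,
      fun _ _ hpq => ⟨hpq.2, hpq.1⟩⟩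
  let g : S.graph ⟶ PartOrd.dual.obj R.graph := PartOrd.ofHom
    ⟨fun p => OrderDual.toDual ⟨(OrderDual.toDual p.1.2, OrderDual.ofDual p.1.1), (h _ _).2 p.2⟩,
      fun _ _ hpq => ⟨hpq.2, hpq.1⟩⟩
  constructor
  · rintro ⟨w, h₀, h₁⟩
    let w' : T.obj (PartOrd.dual.obj R.graph) := OrderDual.ofDual w
    have h₀' : T.map (PartOrd.dual.map R.p₀) w' ≤ T.map d t := h₀
    have h₁' : α' ≤ T.map (PartOrd.dual.map R.p₁) w' := h₁
    refine ⟨T.map f w', ?_, ?_⟩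
    · rw [map_map f S.p₀ (PartOrd.dual.map R.p₁) rfl]
      exact h₁'
    · rw [map_map f S.p₁ (PartOrd.dual.map R.p₀ ≫ d') rfl,
        ← map_map (PartOrd.dual.map R.p₀) d' _ rfl]
      refine ((T.map d').hom.monotone h₀').trans ?_
      change T.map d' (T.map d t) ≤ t
      rw [map_map d d' (𝟙 X) rfl, T.map_id]
      exact le_rfl
  · rintro ⟨w, h₀, h₁⟩
    refine ⟨OrderDual.toDual (T.map g w), ?_, ?_⟩
    · change T.map (PartOrd.dual.map R.p₀) (T.map g w) ≤ T.map d t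
      rw [map_map g (PartOrd.dual.map R.p₀) (S.p₁ ≫ d) rfl, ← map_map S.p₁ d _ rfl]
      exact (T.map d).hom.monotone h₁
    · change α' ≤ T.map (PartOrd.dual.map R.p₁) (T.map g w)
      rw [map_map g (PartOrd.dual.map R.p₁) S.p₀ rfl]
      exact h₀

end lifting

/-! ### Truth and failure as monotone relations. -/

section modalities

variable {T : PartOrd.{u} ⥤ PartOrd.{u}} {At X : PartOrd.{u}} (c : X ⟶ T.obj X)
  (V : MRel At (PartOrd.dual.obj X)) (x : X)

theorem Sat.mono_formula {x : X} {a b : Lang T At} (hab : a ≤ b) (h : Sat c V x a) :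
    Sat c V x b :=
  (sat c V).mono h le_rfl hab

theorem Sat.mono_state {x y : X} {a : Lang T At} (hxy : x ≤ y) (h : Sat c V x a) :
    Sat c V y a :=
  (sat c V).mono h hxy le_rfl

/-- The semantics relation, as a relation from states to formulas. -/
noncomputable def satConverse : MRel X (PartOrd.dual.obj (Lang T At)) where
  rel a x := Sat c V x (OrderDual.ofDual a)
  mono h ha hx := ((h.mono_formula c V ha).mono_state c V hx)

/-- The failure of a finite disjunction. -/
noncomputable def nsatDisj : MRel (PartOrd.dual.obj (Lω.obj (Lang T At))) X where
  rel x l := ¬ Sat c V x (disj T At (OrderDual.ofDual l))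
  mono h hx hl h' := h ((h'.mono_state c V hx).mono_formula c V ((disj T At).hom.monotone hl))

/-- The formulas of a finite set `B` that fail at a state, as a map `X ⟶ (𝕃_ω B)ᵒᵖ`. -/
noncomputable def failing {B : Set (Lang T At)} (hB : B.Finite) :
    X ⟶ PartOrd.dual.obj (Lω.obj (PartOrd.of B)) :=
  -- Finiteness of `B` is what makes the lowerset of failing formulas finitely generated.
  have := hB.to_subtype
  PartOrd.ofHom
    ⟨fun x => OrderDual.toDual (genL (X := PartOrd.of B) {b : B | ¬ Sat c V x b.1}
      (Set.toFinite _)), fun _ _ hxy => lowerClosure_mono fun _ hb h => hb (h.mono_state c V hxy)⟩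

/-- Failure passes to smaller formulas, so the failing formulas in `B` already form a lowerset and
the closure adds none. -/
theorem memL_failing {B : Set (Lang T At)} (hB : B.Finite) (b : PartOrd.of B) :
    memL b (OrderDual.ofDual (failing c V hB x)) ↔ ¬ Sat c V x b.1 := by
  constructor
  · rintro ⟨b', hb', hle⟩ h
    exact hb' (h.mono_formula c V hle)
  · intro h
    exact ⟨b, h, le_rfl⟩

theorem sat_bigConj {s : Set (Lang T At)} (hs : s.Finite) :
    Sat c V x (bigConj T At s hs) ↔ ∀ a ∈ s, Sat c V x a := by
  refine (sat_conj c V x _).trans ⟨fun h a ha => h a ⟨a, ha, le_rfl⟩, ?_⟩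
  rintro h a ⟨b, hb, hle⟩
  exact (h b hb).mono_formula c V hle

/-! ### The two implications between `∇` and `Δ`. -/

variable [PreservesFilteredColimits T]

/-- Passing from `T^∂` to `T` turns the semantic relation around, so that its lifting can be
composed with the lifting that describes `Δ`. -/
theorem sat_nabla_iff (hT : PreservesExactSquares T) (α : (dualFunctor T).obj (Lang T At)) :
    Sat c V x (nabla T At α) ↔ (lift T (satConverse c V)).rel (OrderDual.ofDual α) (c x) :=
  (sat_nabla c V x hT α).trans
    (lift_dualFunctor (sat c V) (satConverse c V) (fun _ _ => Iff.rfl) _ _)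

/-- Restriction along the dual of `⋁` absorbs `T^∂⋁` into the lifted relation. -/
theorem not_sat_deltaDisj_iff (hT : PreservesExactSquares T)
    (Ψ : (dualFunctor T).obj (Lω.obj (Lang T At))) :
    ¬ Sat c V x (deltaDisj T At Ψ) ↔ (lift T (nsatDisj c V)).rel (c x) (OrderDual.ofDual Ψ) :=
  (sat_delta c V x hT _).trans
    (lift_restrict hT (nsat c V) (nsatDisj c V) (PartOrd.dual.map (disj T At))
      (fun _ _ => Iff.rfl) _ _).symm

/-- Composing the liftings at `c x` would otherwise relate `α` to `Ψ` by the lifted `∉`. -/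
theorem sat_deltaDisj_of_sat_nabla (hT : PreservesExactSquares T)
    (α : (dualFunctor T).obj (Lang T At)) (Ψ : (dualFunctor T).obj (Lω.obj (Lang T At)))
    (hΨ : notLiftNotMem T α Ψ) (h : Sat c V x (nabla T At α)) :
    Sat c V x (deltaDisj T At Ψ) := by
  by_contra hn
  refine hΨ (lift_comp hT (nsatDisj c V) (satConverse c V) (notMem _) ?_
    ((sat_nabla_iff c V x hT α).1 h) ((not_sat_deltaDisj_iff c V x hT Ψ).1 hn))
  intro a y l ha hl hmem
  exact hl ((sat_disj c V y _).2 ⟨_, hmem, ha⟩)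

/-- The counterexample records, along `c x`, which formulas of the base fail at each state. -/
theorem exists_not_sat_deltaDisj (hT : PreservesExactSquares T)
    (hI : PreservesFiniteIntersections T) (α : (dualFunctor T).obj (Lang T At))
    (h : ¬ Sat c V x (nabla T At α)) :
    ∃ Ψ ∈ R T α, ¬ Sat c V x (deltaDisj T At (inclBase T α Ψ)) := by
  obtain ⟨hB, a, ha⟩ := base_spec_aux (dualFunctor T) hI.dual α
  let α' : T.obj (PartOrd.dual.obj (Lang T At)) := OrderDual.ofDual α
  let B := base (dualFunctor T) α
  let i : PartOrd.of B ⟶ Lang T At := incl B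
  let f := failing c V hB
  -- The same lowersets, now generated in the whole language: `j y` contains every formula below
  -- some failing formula of `B`.
  let j : X ⟶ PartOrd.dual.obj (Lω.obj (Lang T At)) := f ≫ PartOrd.dual.map (Lω.map i)
  have hj : T.map (PartOrd.dual.map (Lω.map i)) (T.map f (c x)) = T.map j (c x) :=
    map_map f _ j rfl _
  have mem_j (y : X) (b : Lang T At) : memL b (OrderDual.ofDual (j y)) ↔
      ∃ b' : PartOrd.of B, ¬ Sat c V y b'.1 ∧ b ≤ b'.1 := by
    refine (memL_map i (OrderDual.ofDual (f y)) b).trans (exists_congr fun b' => ?_)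
    exact and_congr (memL_failing c V y hB b') Iff.rfl
  refine ⟨OrderDual.toDual (T.map f (c x)), fun hl => h ?_, ?_⟩
  · let S : MRel X (PartOrd.dual.obj (Lang T At)) :=
      { rel := fun b y => ¬ memL (X := Lang T At) (OrderDual.ofDual b) (OrderDual.ofDual (j y))
        mono := fun h hb hy => (notMem _).mono h hb (j.hom.monotone hy) }
    let S' : MRel X (PartOrd.dual.obj (PartOrd.of B)) :=
      { rel := fun b y => Sat c V y (OrderDual.ofDual b).1
        mono := fun h hb hy => (h.mono_formula c V hb).mono_state c V hy }
    have hS : (lift T S).rel α' (c x) := by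
      refine (lift_restrict hT (notMem _) S j (fun _ _ => Iff.rfl) _ _).2 ?_
      rw [← hj]
      exact hl
    have hα : T.map (PartOrd.dual.map i) (OrderDual.ofDual a) = α' := ha
    rw [← hα] at hS
    refine (sat_nabla_iff c V x hT α).2 ?_
    change (lift T (satConverse c V)).rel α' (c x)
    rw [← hα]
    -- As `α` is the image of `a`, the lifting of `S` descends to `S'` at `a` and then ascends to
    -- the semantic relation.
    refine (lift_corestrict hT _ S' _ (fun _ _ => Iff.rfl) _ _).1
      ((lift_corestrict hT S S' _ (fun b y => ?_) _ _).2 hS)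
    refine Iff.trans ?_ (not_congr (mem_j y _)).symm
    constructor
    · rintro hb ⟨b', hb', hle⟩
      exact hb' (hb.mono_formula c V hle)
    · intro hb
      by_contra hn
      exact hb ⟨OrderDual.ofDual b, hn, le_rfl⟩
  · refine (not_sat_deltaDisj_iff c V x hT _).2 ?_
    change (lift T (nsatDisj c V)).rel (c x)
      (T.map (PartOrd.dual.map (Lω.map i)) (T.map f (c x)))
    rw [hj]
    -- It suffices that `⋁ (j y)` fails at each state `y`: every formula in `j y` lies below one
    -- that fails there.
    refine lift_map _ j (fun y hy => ?_) _
    obtain ⟨b, hb, hsat⟩ := (sat_disj c V y _).1 hy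
    obtain ⟨b', hb', hle⟩ := (mem_j y b).1 hb
    exact hb' (hsat.mono_formula c V hle)

end modalities

end MossLogic

theorem mainTheorem5 (T : PartOrd.{u} ⥤ PartOrd.{u}) [PreservesFilteredColimits T]
    (hmono : MossLogic.LocallyMonotone T) (hexact : MossLogic.PreservesExactSquares T)
    (hinter : MossLogic.PreservesFiniteIntersections T) (At : PartOrd.{u})
    (α : (MossLogic.dualFunctor T).obj (MossLogic.Lang T At)) :
    (∀ (X : PartOrd.{u}) (c : X ⟶ T.obj X) (V : MossLogic.MRel At (PartOrd.dual.obj X)) (x : X),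
      MossLogic.Sat c V x (MossLogic.nabla T At α) ↔
        ∀ Ψ : (MossLogic.dualFunctor T).obj (MossLogic.Lω.obj (MossLogic.Lang T At)),
          MossLogic.notLiftNotMem T α Ψ → MossLogic.Sat c V x (MossLogic.deltaDisj T At Ψ)) ∧
    ∀ hfin : (MossLogic.R T α).Finite,
      MossLogic.SemEquiv (MossLogic.nabla T At α)
        (MossLogic.bigConj T At
          ((fun Ψ => MossLogic.deltaDisj T At (MossLogic.inclBase T α Ψ)) '' MossLogic.R T α)
          (hfin.image _)) := by
  constructor
  · intro X c V x
    refine ⟨fun h Ψ hΨ => MossLogic.sat_deltaDisj_of_sat_nabla c V x hexact α Ψ hΨ h, fun h => ?_⟩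
    by_contra hn
    obtain ⟨Ψ, hΨ, hsat⟩ := MossLogic.exists_not_sat_deltaDisj c V x hexact hinter α hn
    exact hsat (h _ hΨ)
  · intro hfin X c V x
    refine Iff.trans ?_ (MossLogic.sat_bigConj c V x _).symm
    constructor
    · rintro h _ ⟨Ψ, hΨ, rfl⟩
      exact MossLogic.sat_deltaDisj_of_sat_nabla c V x hexact α _ hΨ h
    · intro h
      by_contra hn
      obtain ⟨Ψ, hΨ, hsat⟩ := MossLogic.exists_not_sat_deltaDisj c V x hexact hinter α hn
      exact hsat (h _ ⟨Ψ, hΨ, rfl⟩)
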